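/- Let $T=(V,E)$ be a tree (undirected, finite) on $n=|V|$ vertices. A separator query on $T$ takes $a,b,c\in V$ and returns $sep(a,b,c)=1$ if removing the vertex $b$ disconnects $a$ from $c$ (that is, if $b$ lies on the path from $a$ to $c$, end points included), and $0$ otherwise. A deterministic learning algorithm knows $V$ but not $E$; it adaptively asks separator queries, each query depending only on the answers received so far, and finally reports an edge set; formally it is a decision tree. It learns $T$ if the reported edge set is $E$. The height of $T$ rooted at $r\in V$ is the largest distance from $r$ to a vertex of $T$. **Theorem.** Fix $d\in\mathbb{N}$. There is a constant $C$ depending only on $d$ such that for every finite set $V$ with $n=|V|$ the following hold. (1) There is a deterministic algorithm on $V$ which learns every tree $T$ on $V$ of maximum degree at most $d$, and which, if $T$ rooted at some vertex $r$ has height $h$, asks at most $C\,n\,h$ separator queries on $T$. The algorithm is given neither $r$ nor $h$. (2) There is a deterministic algorithm on $V$ which learns every tree $T$ on $V$ of maximum degree at most $d$ (of arbitrary height) with at most $C\,n^{3/2}\sqrt{\log n}$ separator queries. -/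

import Mathlib

universe u

/-- Removing the vertex `b` disconnects `a` from `c`: it is not the case that `a` and `c` both
survive the removal of `b` and are joined by a walk in what remains.  In particular this holds
when `b = a` or `b = c`; in a tree it says that `b` lies on the path from `a` to `c`. -/
def Separates {V : Type u} (G : SimpleGraph V) (a b c : V) : Prop :=
  ¬ ∃ (ha : a ∈ ({b}ᶜ : Set V)) (hc : c ∈ ({b}ᶜ : Set V)),
    (G.induce ({b}ᶜ : Set V)).Reachable ⟨a, ha⟩ ⟨c, hc⟩

open Classical in
/-- The separator query `sep(a, b, c)` on `G`. -/
noncomputable def sepQuery {V : Type u} (G : SimpleGraph V) (a b c : V) : Bool :=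
  decide (Separates G a b c)

/-- A deterministic adaptive learning algorithm on the known vertex set `V`, as a decision tree:
it either halts and reports a graph on `V`, or asks a query `(a, b, c)` and continues according
to the answer. -/
inductive SepLearner (V : Type u) : Type u
  | report (G : SimpleGraph V) : SepLearner V
  | ask (a b c : V) (next : Bool → SepLearner V) : SepLearner V

namespace SepLearner

/-- The graph reported by the algorithm when the queries are answered by `oracle`. -/
def output {V : Type u} (oracle : V → V → V → Bool) : SepLearner V → SimpleGraph V
  | report G => G
  | ask a b c next => output oracle (next (oracle a b c))

/-- The number of queries asked by the algorithm when the queries are answered by `oracle`. -/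
def numQueries {V : Type u} (oracle : V → V → V → Bool) : SepLearner V → ℕ
  | report _ => 0
  | ask a b c next => numQueries oracle (next (oracle a b c)) + 1

end SepLearner

/-- The algorithm `A`, run on the hidden graph `G` with separator queries, reports exactly `G`
after at most `q` queries. -/
def LearnsWithin {V : Type u} (A : SepLearner V) (G : SimpleGraph V) (q : ℝ) : Prop :=
  A.output (sepQuery G) = G ∧ (A.numQueries (sepQuery G) : ℝ) ≤ q

/-- Every vertex of `G` has at most `d` neighbours. -/
def HasDegreeAtMost {V : Type u} (G : SimpleGraph V) (d : ℕ) : Prop :=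
  ∀ v : V, (G.neighborSet v).encard ≤ d

/-- `h` is the height of `T` rooted at `r`: the largest distance from `r` to a vertex
(for a tree, the length of a longest path directed away from `r`). -/
def HasHeight {V : Type u} (T : SimpleGraph V) (r : V) (h : ℕ) : Prop :=
  T.eccent r = h

/-! ### The separation order seen from a root. -/

section DominatorOrder

variable {V : Type u}

/-! Fix any vertex `r`. The queries sep(r, x, y) decide the ancestor order of the tree rooted at
`r`, and the edges are its parent-child pairs (`adj_iff_parentRel`).

To learn the vertices `S` hanging at `p`, a linear scan finds a minimal `c` in `S`, which is a child
of `p`. Then `S` is split into what lies above `c` and the rest, and both are handled recursively. A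
round costs 2|S| queries and is charged to the pairs (u, c) with u in `S`. A pair (u, y) is charged
at most once, and only if the parent of y is a proper ancestor of u, so each u receives at most d
times its depth (`card_chargedPairs_split`, `card_chargedPairs_le`). This is (1), since the depth
from `r` is at most 2h.

For (2) the depth is first cut down. Within blocks of s vertices all pairs are compared and one
parity class of depths is kept. This halves the set, while every chain loses about half of its
elements. After about log₂ s rounds a net of O(s) vertices remains that meets every long chain
(`exists_net`). The groups hanging at net vertices have depth O(s), so the first procedure learns
them all with O(dns) queries, where s ~ √(n log n). -/

theorem separates_iff_forall_walk {G : SimpleGraph V} {a b c : V} :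
    Separates G a b c ↔ ∀ w : G.Walk a c, b ∈ w.support := by
  constructor
  · intro h w
    by_contra hb
    refine h ⟨?_, ?_, ⟨w.induce _ ?_⟩⟩
    · rintro rfl; exact hb w.start_mem_support
    · rintro rfl; exact hb w.end_mem_support
    · intro x hx hxb
      rw [Set.mem_singleton_iff] at hxb
      exact hb (hxb ▸ hx)
  · rintro h ⟨ha, hc, ⟨w⟩⟩
    let φ := (SimpleGraph.Embedding.induce (G := G) ({b}ᶜ : Set V)).toHom
    have : b ∈ (w.map φ).support := h (w.map φ)
    rw [SimpleGraph.Walk.support_map, List.mem_map] at this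
    obtain ⟨x, -, hx⟩ := this
    exact x.2 hx

/-- An order with least element `r` in which the elements below any given one form a chain. -/
structure IsRootedOrder (le : V → V → Prop) (r : V) : Prop where
  refl : ∀ x, le x x
  trans : ∀ {x y z}, le x y → le y z → le x z
  antisymm : ∀ {x y}, le x y → le y x → x = y
  bot : ∀ x, le r x
  total_below : ∀ {x y z}, le x z → le y z → le x y ∨ le y x

/-- The strict part of a relation. -/
def StrictRel (le : V → V → Prop) (x y : V) : Prop := le x y ∧ x ≠ y

/-- `x` is the parent of `y` in a rooted order. -/
def ParentRel (le : V → V → Prop) (x y : V) : Prop :=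
  StrictRel le x y ∧ ∀ z, StrictRel le x z → ¬ StrictRel le z y

variable {G : SimpleGraph V} {r x y z : V}

theorem Separates.dist_lt (hG : G.Connected) (h : Separates G r x y) (hne : x ≠ y) :
    G.dist r x < G.dist r y := by
  classical
  obtain ⟨w, hw⟩ := hG.exists_walk_length_eq_dist r y
  have hx := separates_iff_forall_walk.1 h w
  have h1 := SimpleGraph.dist_le (w.takeUntil x hx)
  have h2 := w.length_takeUntil_lt_length hx hne
  omega

/-- Connectedness suffices: this is the dominator order of a graph with root `r`. -/
theorem isRootedOrder_separates (hG : G.Connected) (r : V) :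
    IsRootedOrder (Separates G r) r where
  refl x := separates_iff_forall_walk.2 fun w => w.end_mem_support
  bot x := separates_iff_forall_walk.2 fun w => w.start_mem_support
  trans {x y z} hxy hyz := by
    classical
    rw [separates_iff_forall_walk] at *
    intro w
    exact w.support_takeUntil_subset_support (hyz w) (hxy _)
  antisymm {x y} hxy hyx := by
    by_contra hne
    exact lt_asymm (hxy.dist_lt hG hne) (hyx.dist_lt hG (Ne.symm hne))
  total_below {x y z} hxz hyz := by
    classical
    -- A shortest walk from `x` to `z` misses `y`, as `y` is no closer to `z`. So a walk from `r` to
    -- `x` avoiding `y` would extend to `z`.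
    have key : ∀ {x y : V}, Separates G r y z → G.dist x z ≤ G.dist y z → x ≠ y →
        Separates G r y x := by
      intro x y hyz hle hne
      rw [separates_iff_forall_walk] at *
      intro w
      by_contra hw
      obtain ⟨w', hw'⟩ := hG.exists_walk_length_eq_dist x z
      have hy : y ∈ w'.support := by
        have := hyz (w.append w')
        rw [SimpleGraph.Walk.mem_support_append_iff] at this
        exact this.resolve_left hw
      have h1 := SimpleGraph.dist_le (w'.dropUntil y hy)
      have h2 := congrArg SimpleGraph.Walk.length (w'.take_spec hy)
      rw [SimpleGraph.Walk.length_append] at h2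
      have h3 : (w'.takeUntil y hy).length ≠ 0 := fun h =>
        hne (SimpleGraph.Walk.eq_of_length_eq_zero h)
      omega
    by_cases hne : x = y
    · subst hne
      exact Or.inl (separates_iff_forall_walk.2 fun w => w.end_mem_support)
    rcases le_total (G.dist x z) (G.dist y z) with h | h
    · exact Or.inr (key hyz h hne)
    · exact Or.inl (key hxz h (Ne.symm hne))

/-- Otherwise a walk to `x` avoiding `y` and a walk to `y` avoiding `x` would join into a detour
around the bridge `xy`. -/
theorem separates_or_separates_of_adj (hG : G.IsTree) (r : V) (h : G.Adj x y) :
    Separates G r x y ∨ Separates G r y x := by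
  by_contra hcon
  rw [not_or, separates_iff_forall_walk, separates_iff_forall_walk] at hcon
  push Not at hcon
  obtain ⟨⟨w, hw⟩, ⟨w', hw'⟩⟩ := hcon
  have hb := SimpleGraph.isAcyclic_iff_forall_adj_isBridge.1 hG.isAcyclic h
  rw [SimpleGraph.isBridge_iff_forall_walk_mem_edges] at hb
  have := hb (w'.reverse.append w)
  rw [SimpleGraph.Walk.edges_append, List.mem_append, SimpleGraph.Walk.edges_reverse,
    List.mem_reverse] at this
  rcases this with h1 | h1
  · exact hw' (w'.snd_mem_support_of_mem_edges h1)
  · exact hw (w.fst_mem_support_of_mem_edges h1)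

theorem parentRel_of_adj_of_separates (hG : G.IsTree) (h : G.Adj x y) (hxy : Separates G r x y) :
    ParentRel (Separates G r) x y := by
  have ho := isRootedOrder_separates hG.connected r
  refine ⟨⟨hxy, h.ne⟩, fun z hxz hzy => ?_⟩
  have hzx : ¬ Separates G r z x := fun hzx => hxz.2 (ho.antisymm hxz.1 hzx)
  rw [separates_iff_forall_walk] at hzx
  push Not at hzx
  obtain ⟨w, hw⟩ := hzx
  have := separates_iff_forall_walk.1 hzy.1 (w.concat h)
  rw [SimpleGraph.Walk.support_concat, List.mem_append,
    List.mem_singleton] at this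
  exact this.elim hw hzy.2

/-- The neighbour of `y` on a shortest walk to `r` is a parent of `y`, and parents are unique
because lower sets are chains. -/
theorem adj_of_parentRel (hG : G.IsTree) (h : ParentRel (Separates G r) x y) : G.Adj x y := by
  have ho := isRootedOrder_separates hG.connected r
  have hry : y ≠ r := by
    rintro rfl
    exact h.1.2 (ho.antisymm h.1.1 (ho.bot x))
  obtain ⟨w, hw⟩ := hG.connected.exists_walk_length_eq_dist y r
  cases w with
  | nil => exact absurd rfl hry
  | @cons _ v _ hadj w =>
    have hd : G.dist r v < G.dist r y := by
      have := SimpleGraph.dist_le w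
      rw [SimpleGraph.Walk.length_cons] at hw
      rw [SimpleGraph.dist_comm, SimpleGraph.dist_comm (u := r)]
      omega
    have hvy : Separates G r v y := by
      rcases separates_or_separates_of_adj hG r hadj with h' | h'
      · exact absurd (h'.dist_lt hG.connected hadj.ne) (by omega)
      · exact h'
    have hpar := parentRel_of_adj_of_separates hG hadj.symm hvy
    suffices x = v from this ▸ hadj.symm
    by_contra hne
    rcases ho.total_below h.1.1 hvy with hxv | hvx
    · exact h.2 v ⟨hxv, hne⟩ hpar.1
    · exact hpar.2 x ⟨hvx, Ne.symm hne⟩ h.1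

theorem adj_iff_parentRel (hG : G.IsTree) (r : V) :
    G.Adj x y ↔ ParentRel (Separates G r) x y ∨ ParentRel (Separates G r) y x := by
  constructor
  · intro h
    exact (separates_or_separates_of_adj hG r h).imp (parentRel_of_adj_of_separates hG h)
      (parentRel_of_adj_of_separates hG h.symm)
  · rintro (h | h)
    · exact adj_of_parentRel hG h
    · exact (adj_of_parentRel hG h).symm

theorem ncard_strictRel_le_dist (hG : G.Connected) (r y : V) :
    {x | StrictRel (Separates G r) x y}.ncard ≤ G.dist r y := by
  classical
  obtain ⟨w, hw⟩ := hG.exists_walk_length_eq_dist r y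
  have hsub : {x | StrictRel (Separates G r) x y} ⊆ (w.support.toFinset.erase y : Finset V) := by
    intro x hx
    rw [Finset.mem_coe, Finset.mem_erase, List.mem_toFinset]
    exact ⟨hx.2, separates_iff_forall_walk.1 hx.1 w⟩
  have h1 := Set.ncard_le_ncard hsub (Finset.finite_toSet _)
  rw [Set.ncard_coe_finset,
    Finset.card_erase_of_mem (List.mem_toFinset.2 w.end_mem_support)] at h1
  have h2 := w.support.toFinset_card_le
  rw [SimpleGraph.Walk.length_support] at h2
  omega

theorem ncard_parentRel_le [Finite V] (hG : G.IsTree) {d : ℕ} (hd : HasDegreeAtMost G d)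
    (r x : V) : {y | ParentRel (Separates G r) x y}.ncard ≤ d := by
  have hsub : {y | ParentRel (Separates G r) x y} ⊆ G.neighborSet x :=
    fun y hy => adj_of_parentRel hG hy
  refine (Set.ncard_le_ncard hsub (Set.toFinite _)).trans ?_
  have := hd x
  rw [← (Set.toFinite (G.neighborSet x)).cast_ncard_eq] at this
  exact_mod_cast this

end DominatorOrder

/-! ### Composing query procedures and adding their costs. -/

section SepComputes

open scoped Classical

universe v w

variable {V : Type u} {α : Type v} {β : Type w}

/-- The value `f G` can be found with at most `q G` separator queries on any graph `G`
satisfying `P`: every way of continuing once the value is known can be preceded by queries that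
find it. -/
def SepComputes (P : SimpleGraph V → Prop) (f : SimpleGraph V → α) (q : SimpleGraph V → ℕ) :
    Prop :=
  ∀ k : α → SepLearner V, ∃ A : SepLearner V, ∀ G, P G →
    A.output (sepQuery G) = (k (f G)).output (sepQuery G) ∧
      A.numQueries (sepQuery G) ≤ q G + (k (f G)).numQueries (sepQuery G)

namespace SepComputes

variable {P P' : SimpleGraph V → Prop} {f f' : SimpleGraph V → α} {q q' : SimpleGraph V → ℕ}

theorem mono (h : SepComputes P f q) (hP : ∀ G, P' G → P G) (hf : ∀ G, P' G → f G = f' G)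
    (hq : ∀ G, P' G → q G ≤ q' G) : SepComputes P' f' q' := by
  intro k
  obtain ⟨A, hA⟩ := h k
  refine ⟨A, fun G hG => ?_⟩
  obtain ⟨h1, h2⟩ := hA G (hP G hG)
  rw [hf G hG] at h1 h2
  exact ⟨h1, h2.trans (Nat.add_le_add_right (hq G hG) _)⟩

theorem const (P : SimpleGraph V → Prop) (a : α) : SepComputes P (fun _ => a) (fun _ => 0) :=
  fun k => ⟨k a, fun _ _ => ⟨rfl, by simp⟩⟩

theorem query (P : SimpleGraph V → Prop) (a b c : V) :
    SepComputes P (fun G => sepQuery G a b c) (fun _ => 1) :=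
  fun k => ⟨.ask a b c k, fun _ _ => ⟨rfl, (Nat.add_comm _ _).le⟩⟩

/-- The second stage need only work on graphs with `f G = a`; this is how answers already received
become hypotheses later. -/
theorem bind (hf : SepComputes P f q) {g : α → SimpleGraph V → β} {p : α → SimpleGraph V → ℕ}
    (hg : ∀ a, SepComputes (fun G => P G ∧ f G = a) (g a) (p a)) :
    SepComputes P (fun G => g (f G) G) (fun G => q G + p (f G) G) := by
  intro k
  choose A hA using fun a => hg a k
  obtain ⟨B, hB⟩ := hf A
  refine ⟨B, fun G hG => ?_⟩
  obtain ⟨h1, h2⟩ := hB G hG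
  obtain ⟨h3, h4⟩ := hA (f G) G ⟨hG, rfl⟩
  exact ⟨h1.trans h3, h2.trans (by dsimp only; omega)⟩

theorem map (hf : SepComputes P f q) (g : α → β) : SepComputes P (fun G => g (f G)) q :=
  (hf.bind fun a => const _ (g a)).mono (fun _ h => h) (fun _ _ => rfl) (fun _ _ => le_rfl)

theorem filter_query {ι : Type v} (P : SimpleGraph V → Prop) (S : Finset ι) (a b c : ι → V) :
    SepComputes P (fun G => S.filter fun i => Separates G (a i) (b i) (c i))
      (fun _ => S.card) := by
  induction S using Finset.induction_on with
  | empty => exact (const P ∅).mono (fun _ h => h) (fun _ _ => by simp) (by simp)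
  | insert i S hi ih =>
    refine (ih.bind (g := fun F G => if sepQuery G (a i) (b i) (c i) = true then insert i F else F)
      (p := fun _ _ => 1)
      (fun F => (query _ (a i) (b i) (c i)).map (fun t => if t = true then insert i F else F))).mono
      (fun _ h => h) (fun G _ => ?_) (fun _ _ => ?_)
    · simp only [sepQuery, decide_eq_true_eq]
      rw [Finset.filter_insert]
    · rw [Finset.card_insert_of_notMem hi]

theorem biUnion {ι : Type w} (S : Finset ι) {f : ι → SimpleGraph V → Set α}
    {q : ι → SimpleGraph V → ℕ} (h : ∀ i ∈ S, SepComputes P (f i) (q i)) :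
    SepComputes P (fun G => ⋃ i ∈ S, f i G) (fun G => ∑ i ∈ S, q i G) := by
  induction S using Finset.induction_on with
  | empty => exact (const P ∅).mono (fun _ h => h) (fun _ _ => by simp) (by simp)
  | insert i S hi ih =>
    have ih' := ih fun j hj => h j (Finset.mem_insert_of_mem hj)
    have hi' := h i (Finset.mem_insert_self i S)
    refine (hi'.bind (g := fun X G => X ∪ ⋃ i ∈ S, f i G) (p := fun _ G => ∑ i ∈ S, q i G)
      (fun X => (ih'.mono (fun _ h => h.1) (fun _ _ => rfl) (fun _ _ => le_rfl)).map
        (fun Y => X ∪ Y))).mono (fun _ h => h) (fun G _ => ?_) (fun G _ => ?_)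
    · rw [Finset.set_biUnion_insert]
    · rw [Finset.sum_insert hi]

theorem exists_learner {q : SimpleGraph V → ℕ} (h : SepComputes P (fun G => G) q) :
    ∃ A : SepLearner V, ∀ G, P G → A.output (sepQuery G) = G ∧ A.numQueries (sepQuery G) ≤ q G :=
  h .report

end SepComputes

end SepComputes

/-! ### The recursive procedure and its charging scheme. -/

section LearnSubtree

open scoped Classical

variable {V : Type u}

namespace IsRootedOrder

variable {le : V → V → Prop} {r x y z : V}

theorem strict_of_le_of_strict (ho : IsRootedOrder le r) (h : le x y) (h' : StrictRel le y z) :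
    StrictRel le x z := by
  refine ⟨ho.trans h h'.1, ?_⟩
  rintro rfl
  exact h'.2 (ho.antisymm h'.1 h)

theorem strict_of_strict_of_le (ho : IsRootedOrder le r) (h : StrictRel le x y) (h' : le y z) :
    StrictRel le x z := by
  refine ⟨ho.trans h.1 h', ?_⟩
  rintro rfl
  exact h.2 (ho.antisymm h.1 h')

theorem le_of_strict_of_parentRel (ho : IsRootedOrder le r) (h : StrictRel le x z)
    (h' : ParentRel le y z) : le x y := by
  rcases ho.total_below h.1 h'.1.1 with hxy | hyx
  · exact hxy
  · by_cases hne : y = x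
    · exact hne ▸ ho.refl y
    · exact absurd h (h'.2 x ⟨hyx, hne⟩)

theorem parentRel_unique (ho : IsRootedOrder le r) (h : ParentRel le x z)
    (h' : ParentRel le y z) : x = y :=
  ho.antisymm (ho.le_of_strict_of_parentRel h.1 h') (ho.le_of_strict_of_parentRel h'.1 h)

end IsRootedOrder

/-- `S` consists of vertices strictly above `p` and contains, with each vertex, all those between
`p` and it. -/
def IsHangingAt (le : V → V → Prop) (p : V) (S : Finset V) : Prop :=
  ∀ u ∈ S, StrictRel le p u ∧ ∀ x, StrictRel le p x → le x u → x ∈ S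

/-- The pairs (parent, child) with child in `S`. -/
def parentPairs (le : V → V → Prop) (S : Finset V) : Set (V × V) :=
  {e | e.2 ∈ S ∧ ParentRel le e.1 e.2}

/-- The pairs `(u, y)` in `S` such that the parent of `y` lies strictly below `u`. -/
noncomputable def chargedPairs (le : V → V → Prop) (S : Finset V) : Finset (V × V) :=
  (S ×ˢ S).filter fun e => ∃ z, ParentRel le z e.2 ∧ StrictRel le z e.1

variable {le : V → V → Prop} {r p c : V} {S : Finset V}

theorem IsHangingAt.parentRel_of_minimal (hS : IsHangingAt le p S)
    (hc : c ∈ S) (hmin : ∀ x ∈ S, le x c → x = c) : ParentRel le p c := by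
  refine ⟨(hS c hc).1, fun z hpz hzc => hzc.2 (hmin z ((hS c hc).2 z hpz hzc.1) hzc.1)⟩

theorem IsHangingAt.above (ho : IsRootedOrder le r) (hS : IsHangingAt le p S)
    (hc : c ∈ S) : IsHangingAt le c ((S.filter (le c)).erase c) := by
  intro u hu
  rw [Finset.mem_erase, Finset.mem_filter] at hu
  refine ⟨⟨hu.2.2, Ne.symm hu.1⟩, fun x hcx hxu => ?_⟩
  rw [Finset.mem_erase, Finset.mem_filter]
  exact ⟨Ne.symm hcx.2, (hS u hu.2.1).2 x (ho.strict_of_strict_of_le (hS c hc).1 hcx.1) hxu,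
    hcx.1⟩

theorem IsHangingAt.not_above (ho : IsRootedOrder le r) (hS : IsHangingAt le p S) :
    IsHangingAt le p (S \ S.filter (le c)) := by
  intro u hu
  simp only [Finset.mem_sdiff, Finset.mem_filter, not_and] at hu
  refine ⟨(hS u hu.1).1, fun x hpx hxu => ?_⟩
  simp only [Finset.mem_sdiff, Finset.mem_filter, not_and]
  exact ⟨(hS u hu.1).2 x hpx hxu, fun _ hcx => hu.2 hu.1 (ho.trans hcx hxu)⟩

theorem parentPairs_eq_insert (ho : IsRootedOrder le r) (hp : ParentRel le p c) (hc : c ∈ S) :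
    parentPairs le S = insert (p, c) (parentPairs le ((S.filter (le c)).erase c) ∪
      parentPairs le (S \ S.filter (le c))) := by
  ext ⟨x, y⟩
  simp only [parentPairs, Set.mem_ofPred_eq, Set.mem_insert_iff, Set.mem_union, Prod.mk.injEq,
    Finset.mem_erase, Finset.mem_sdiff, Finset.mem_filter, not_and]
  by_cases hyc : y = c
  · subst hyc
    constructor
    · rintro ⟨-, h⟩
      exact Or.inl ⟨ho.parentRel_unique h hp, rfl⟩
    · rintro (⟨rfl, -⟩ | ⟨⟨h, -⟩, -⟩ | ⟨⟨-, h⟩, -⟩)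
      · exact ⟨hc, hp⟩
      · exact absurd rfl h
      · exact absurd (ho.refl y) (h hc)
  · tauto

/-- The round at `c` is charged to `S ×ˢ {c}`: the parent `p` of `c` lies strictly below all of `S`.
Neither subproblem contains `c` and the two are disjoint, so no pair is charged twice. -/
theorem card_chargedPairs_split (ho : IsRootedOrder le r) (hS : IsHangingAt le p S) (hp : ParentRel le p c) (hc : c ∈ S) :
    S.card + (chargedPairs le ((S.filter (le c)).erase c)).card +
      (chargedPairs le (S \ S.filter (le c))).card ≤ (chargedPairs le S).card := by
  have hsub : (S ×ˢ {c}) ∪ chargedPairs le ((S.filter (le c)).erase c) ∪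
      chargedPairs le (S \ S.filter (le c)) ⊆ chargedPairs le S := by
    rintro ⟨u, y⟩ h
    simp only [chargedPairs, Finset.mem_union, Finset.mem_product, Finset.mem_singleton,
      Finset.mem_filter, Finset.mem_erase, Finset.mem_sdiff] at h ⊢
    rcases h with (⟨hu, rfl⟩ | h) | h
    · exact ⟨⟨hu, hc⟩, p, hp, (hS u hu).1⟩
    · exact ⟨⟨h.1.1.2.1, h.1.2.2.1⟩, h.2⟩
    · exact ⟨⟨h.1.1.1, h.1.2.1⟩, h.2⟩
  refine le_trans (le_of_eq ?_) (Finset.card_le_card hsub)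
  rw [Finset.card_union_of_disjoint, Finset.card_union_of_disjoint, Finset.card_product,
    Finset.card_singleton, mul_one]
  · rw [Finset.disjoint_left]
    rintro ⟨u, y⟩ h h'
    simp only [chargedPairs, Finset.mem_product, Finset.mem_singleton,
      Finset.mem_filter, Finset.mem_erase] at h h'
    exact h'.1.2.1 h.2
  · rw [Finset.disjoint_left]
    rintro ⟨u, y⟩ h h'
    simp only [chargedPairs, Finset.mem_union, Finset.mem_product, Finset.mem_singleton,
      Finset.mem_filter, Finset.mem_erase, Finset.mem_sdiff, not_and] at h h'
    rcases h with ⟨-, rfl⟩ | h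
    · exact h'.1.2.2 hc (ho.refl _)
    · exact h'.1.2.2 h'.1.2.1 h.1.2.2.2

/-- For given `u` there are at most `H` choices of the parent `z` between `p` and `u`, then at most
`d` children `y` of `z`. -/
theorem card_chargedPairs_le [Finite V] (ho : IsRootedOrder le r) (hS : IsHangingAt le p S)
    {d H : ℕ} (hd : ∀ x, {y | ParentRel le x y}.ncard ≤ d)
    (hH : ∀ u ∈ S, {z | le p z ∧ StrictRel le z u}.ncard ≤ H) :
    (chargedPairs le S).card ≤ S.card * (H * d) := by
  have := Fintype.ofFinite V
  have hsub : chargedPairs le S ⊆ S.biUnion fun u =>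
      ({z | le p z ∧ StrictRel le z u} : Finset V).biUnion fun z =>
        ({y | ParentRel le z y} : Finset V).image fun y => (u, y) := by
    rintro ⟨u, y⟩ h
    simp only [chargedPairs, Finset.mem_product, Finset.mem_filter] at h
    obtain ⟨⟨hu, hy⟩, z, hzy, hzu⟩ := h
    simp only [Finset.mem_biUnion, Finset.mem_filter, Finset.mem_univ, true_and,
      Finset.mem_image]
    exact ⟨u, hu, z, ⟨ho.le_of_strict_of_parentRel (hS y hy).1 hzy, hzu⟩, y, hzy, rfl⟩
  refine (Finset.card_le_card hsub).trans (Finset.card_biUnion_le_card_mul _ _ _ fun u hu => ?_)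
  have h1 := hH u hu
  rw [Set.ncard_eq_toFinset_card', Set.toFinset_ofPred] at h1
  refine (Finset.card_biUnion_le_card_mul _ _ d fun z _ => ?_).trans (Nat.mul_le_mul_right d h1)
  have h2 := hd z
  rw [Set.ncard_eq_toFinset_card', Set.toFinset_ofPred] at h2
  exact Finset.card_image_le.trans h2

namespace SepComputes

/-- A scan keeps a candidate, starting with `v`, and replaces it by any new element below it. -/
theorem exists_minimal (r v : V) (S : Finset V) : ∃ f : SimpleGraph V → V,
    SepComputes (fun G => G.IsTree) f (fun _ => S.card) ∧
      ∀ G : SimpleGraph V, G.IsTree → f G ∈ insert v S ∧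
        ∀ x ∈ insert v S, Separates G r x (f G) → x = f G := by
  induction S using Finset.induction_on with
  | empty => exact ⟨_, const _ v, fun G hG => by simp⟩
  | insert a S ha ih =>
    obtain ⟨f, hf, hmin⟩ := ih
    refine ⟨fun G => if sepQuery G r a (f G) = true then a else f G,
      (hf.bind (g := fun c G => if sepQuery G r a c = true then a else c) (p := fun _ _ => 1)
      (fun c => (query _ r a c).map fun t => if t = true then a else c)).mono
      (fun _ h => h) (fun _ _ => rfl) (fun _ _ => ?_), fun G hG => ?_⟩
    · rw [Finset.card_insert_of_notMem ha]
    · have ho := isRootedOrder_separates hG.connected r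
      obtain ⟨h1, h2⟩ := hmin G hG
      have hswap : insert v (insert a S) = insert a (insert v S) := Finset.insert_comm _ _ _
      simp only [sepQuery, decide_eq_true_eq]
      rw [hswap]
      split_ifs with h
      · refine ⟨Finset.mem_insert_self _ _, fun x hx hxa => ?_⟩
        rcases Finset.mem_insert.1 hx with rfl | hx
        · rfl
        · have hxf := h2 x hx (ho.trans hxa h)
          subst hxf
          exact ho.antisymm hxa h
      · refine ⟨Finset.mem_insert_of_mem h1, fun x hx hxf => ?_⟩
        rcases Finset.mem_insert.1 hx with rfl | hx
        · exact absurd hxf h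
        · exact h2 x hx hxf

theorem parentPairs_of_isHangingAt (r : V) (m : ℕ) : ∀ (p : V) (S : Finset V), S.card ≤ m →
    SepComputes (fun G => G.IsTree ∧ IsHangingAt (Separates G r) p S)
      (fun G => parentPairs (Separates G r) S)
      (fun G => 2 * (chargedPairs (Separates G r) S).card) := by
  induction m with
  | zero =>
    intro p S hS
    obtain rfl : S = ∅ := by simpa using hS
    exact (const _ ∅).mono (fun _ h => h) (fun G _ => by simp [parentPairs]) (by simp)
  | succ m ih =>
    intro p S hS
    rcases S.eq_empty_or_nonempty with rfl | ⟨v, hv⟩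
    · exact (const _ ∅).mono (fun _ h => h) (fun G _ => by simp [parentPairs]) (by simp)
    obtain ⟨f, hf, hmin⟩ := exists_minimal r v S
    rw [Finset.insert_eq_of_mem hv] at hmin
    have hsplit : ∀ c, SepComputes
        (fun G => (G.IsTree ∧ IsHangingAt (Separates G r) p S) ∧ f G = c)
        (fun G => insert (p, c)
          (parentPairs (Separates G r) ((S.filter (Separates G r c)).erase c) ∪
          parentPairs (Separates G r) (S \ S.filter (Separates G r c))))
        (fun G => S.card +
          (2 * (chargedPairs (Separates G r) ((S.filter (Separates G r c)).erase c)).card +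
          2 * (chargedPairs (Separates G r) (S \ S.filter (Separates G r c))).card)) := by
      intro c
      by_cases hc : c ∈ S
      swap
      -- No tree gives this answer, so any value will do.
      · exact (const _ ∅).mono (fun _ h => h)
          (fun G h => absurd (h.2 ▸ (hmin G h.1.1).1) hc) (by simp)
      refine ((filter_query _ S (fun _ => r) (fun _ => c) (fun u => u)).bind
        (g := fun A G => insert (p, c) (parentPairs (Separates G r) (A.erase c) ∪
          parentPairs (Separates G r) (S \ A)))
        (p := fun A G => 2 * (chargedPairs (Separates G r) (A.erase c)).card +
          2 * (chargedPairs (Separates G r) (S \ A)).card) fun A => ?_)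
      by_cases hA : A ⊆ S ∧ c ∈ A
      swap
      · refine (const _ ∅).mono (fun _ h => h) (fun G h => absurd ?_ hA) (by simp)
        rw [← h.2]
        refine ⟨Finset.filter_subset _ _, Finset.mem_filter.2 ⟨hc, ?_⟩⟩
        exact (isRootedOrder_separates h.1.1.1.connected r).refl c
      have h1 : (A.erase c).card ≤ m := by
        have := Finset.card_erase_add_one hA.2
        have := Finset.card_le_card hA.1
        omega
      have h2 : (S \ A).card ≤ m := by
        have := Finset.card_sdiff_add_card_eq_card hA.1
        have := Finset.card_pos.2 ⟨c, hA.2⟩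
        omega
      refine (((ih c _ h1).mono
        (P' := fun G => (((G.IsTree ∧ IsHangingAt (Separates G r) p S) ∧ f G = c) ∧
          S.filter (Separates G r c) = A))
        (fun G h => ⟨h.1.1.1, ?_⟩) (fun _ _ => rfl) (fun _ _ => le_rfl)).bind
        (g := fun X G => insert (p, c) (X ∪ parentPairs (Separates G r) (S \ A)))
        (p := fun _ G => 2 * (chargedPairs (Separates G r) (S \ A)).card)
        fun X => ((ih p _ h2).mono
          (fun G h => ⟨h.1.1.1.1, ?_⟩) (fun _ _ => rfl) (fun _ _ => le_rfl)).map
          fun Y => insert (p, c) (X ∪ Y))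
      · rw [← h.2]
        exact h.1.1.2.above (isRootedOrder_separates h.1.1.1.connected r) hc
      · rw [← h.1.2]
        exact h.1.1.1.2.not_above (isRootedOrder_separates h.1.1.1.1.connected r)
    refine ((hf.mono (P' := fun G => G.IsTree ∧ IsHangingAt (Separates G r) p S)
      (fun _ h => h.1) (fun _ _ => rfl) (fun _ _ => le_rfl)).bind hsplit).mono
      (fun _ h => h) (fun G h => ?_) (fun G h => ?_)
    all_goals
      have ho := isRootedOrder_separates h.1.connected r
      obtain ⟨hc, hc'⟩ := hmin G h.1
      have hp := h.2.parentRel_of_minimal hc hc'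
    · exact (parentPairs_eq_insert ho hp hc).symm
    · have := card_chargedPairs_split ho h.2 hp hc
      omega

end SepComputes

/-- The graph with the given (parent, child) pairs as edges. -/
def graphOfPairs (E : Set (V × V)) : SimpleGraph V :=
  SimpleGraph.fromRel fun x y => (x, y) ∈ E

theorem graphOfPairs_eq {G : SimpleGraph V} (hG : G.IsTree) (r : V) :
    graphOfPairs {e | ParentRel (Separates G r) e.1 e.2} = G := by
  ext x y
  rw [graphOfPairs, SimpleGraph.fromRel_adj, adj_iff_parentRel hG r]
  constructor
  · exact fun h => h.2
  · exact fun h => ⟨h.elim (fun h => h.1.2) fun h => h.1.2.symm, h⟩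

end LearnSubtree

/-! ### Thinning the vertex set to a net by parity of depth. -/

section Net

open scoped Classical

variable {V : Type u}

/-- The elements of `W` strictly between `a` and `b`. -/
noncomputable def between (le : V → V → Prop) (W : Finset V) (a b : V) : Finset V :=
  W.filter fun z => StrictRel le a z ∧ StrictRel le z b

/-- The number of elements of `W` that are below or equal to `x`. -/
noncomputable def depthIn (le : V → V → Prop) (W : Finset V) (x : V) : ℕ :=
  (W.filter fun w => le w x).card

variable {le : V → V → Prop} {r a b x y : V} {W : Finset V}

namespace IsRootedOrder

theorem depthIn_lt (ho : IsRootedOrder le r) (hy : y ∈ W) (h : StrictRel le x y) :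
    depthIn le W x < depthIn le W y := by
  refine Finset.card_lt_card ⟨fun w hw => ?_, fun hsub => ?_⟩
  · rw [Finset.mem_filter] at hw ⊢
    exact ⟨hw.1, ho.trans hw.2 h.1⟩
  · have := hsub (Finset.mem_filter.2 ⟨hy, ho.refl y⟩)
    exact h.2 (ho.antisymm h.1 (Finset.mem_filter.1 this).2)

theorem exists_between_eq_insert (ho : IsRootedOrder le r) (h : (between le W a b).Nonempty) :
    ∃ x ∈ between le W a b, between le W a b = insert x (between le W a x) := by
  obtain ⟨x, hx, hmax⟩ := Finset.exists_max_image _ (depthIn le W) h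
  refine ⟨x, hx, ?_⟩
  obtain ⟨hxW, hax, hxb⟩ := Finset.mem_filter.1 hx
  ext z
  rw [Finset.mem_insert, between, between, Finset.mem_filter, Finset.mem_filter]
  constructor
  · rintro ⟨hz, haz, hzb⟩
    by_cases hzx : z = x
    · exact Or.inl hzx
    refine Or.inr ⟨hz, haz, ?_, hzx⟩
    rcases ho.total_below hzb.1 hxb.1 with h | h
    · exact h
    · have h1 := hmax z (Finset.mem_filter.2 ⟨hz, haz, hzb⟩)
      have h2 := ho.depthIn_lt hz ⟨h, Ne.symm hzx⟩
      omega
  · rintro (rfl | ⟨hz, haz, hzx⟩)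
    · exact ⟨hxW, hax, hxb⟩
    · exact ⟨hz, haz, ho.strict_of_strict_of_le hzx hxb.1⟩

theorem depthIn_eq_add_one (ho : IsRootedOrder le r) (hx : x ∈ W) (hy : y ∈ between le W a x)
    (h : between le W a x = insert y (between le W a y)) :
    depthIn le W x = depthIn le W y + 1 := by
  obtain ⟨-, hay, hyx⟩ := Finset.mem_filter.1 hy
  have hnot : x ∉ W.filter fun w => le w y := fun hmem =>
    hyx.2 (ho.antisymm hyx.1 (Finset.mem_filter.1 hmem).2)
  rw [depthIn, depthIn, ← Finset.card_insert_of_notMem hnot]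
  congr 1
  ext w
  rw [Finset.mem_insert, Finset.mem_filter, Finset.mem_filter]
  constructor
  · rintro ⟨hw, hwx⟩
    by_cases hne : w = x
    · exact Or.inl hne
    refine Or.inr ⟨hw, ?_⟩
    rcases ho.total_below hwx hyx.1 with h' | h'
    · exact h'
    · have hmem : w ∈ between le W a x :=
        Finset.mem_filter.2 ⟨hw, ho.strict_of_strict_of_le hay h', hwx, hne⟩
      rw [h, Finset.mem_insert] at hmem
      rcases hmem with rfl | hmem
      · exact ho.refl _
      · exact (Finset.mem_filter.1 hmem).2.2.1
  · rintro (rfl | ⟨hw, hwy⟩)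
    · exact ⟨hx, ho.refl _⟩
    · exact ⟨hw, ho.trans hwy hyx.1⟩

/-- Along a chain of consecutive elements of `W` the parity of the depth alternates. -/
theorem card_between_le (ho : IsRootedOrder le r) (W : Finset V) (a : V) (p : ℕ → Prop)
    (hp : ∀ n, p (n + 1) ↔ ¬ p n) (n : ℕ) : ∀ b, (between le W a b).card ≤ n →
    (between le W a b).card ≤
      2 * (between le (W.filter fun x => p (depthIn le W x)) a b).card + 1 := by
  have hcomm : ∀ b, between le (W.filter fun x => p (depthIn le W x)) a b =
      (between le W a b).filter fun x => p (depthIn le W x) := fun b =>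
    Finset.filter_comm _ _ _
  have hself : ∀ x, x ∉ between le W a x := fun x hx =>
    (Finset.mem_filter.1 hx).2.2.2 rfl
  simp only [hcomm]
  induction n using Nat.strong_induction_on with
  | _ n ih =>
    intro b hb
    rcases (between le W a b).eq_empty_or_nonempty with h | h
    · simp [h]
    obtain ⟨x, hx, hxe⟩ := ho.exists_between_eq_insert h
    have hcx : (between le W a b).card = (between le W a x).card + 1 := by
      rw [hxe, Finset.card_insert_of_notMem (hself x)]
    rcases (between le W a x).eq_empty_or_nonempty with h' | h'
    · rw [h', Finset.card_empty] at hcx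
      omega
    -- The two topmost elements `x`, `y` have consecutive depths, so exactly one survives the
    -- filter; induction handles what lies below `y`.
    obtain ⟨y, hy, hye⟩ := ho.exists_between_eq_insert h'
    have hcy : (between le W a x).card = (between le W a y).card + 1 := by
      rw [hye, Finset.card_insert_of_notMem (hself y)]
    have hd := ho.depthIn_eq_add_one (Finset.mem_filter.1 hx).1 hy hye
    have hIH := ih (between le W a y).card (by omega) y le_rfl
    have hxy : x ∉ insert y (between le W a y) := hye ▸ hself x
    rw [hcx, hcy, hxe, hye, Finset.filter_insert, Finset.filter_insert, hd, hp]
    by_cases hpy : p (depthIn le W y)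
    · rw [if_neg (not_not.2 hpy), if_pos hpy, Finset.card_insert_of_notMem
        fun h => hself y (Finset.mem_filter.1 h).1]
      omega
    · rw [if_pos hpy, if_neg hpy, Finset.card_insert_of_notMem
        fun h => hxy (Finset.mem_insert_of_mem (Finset.mem_filter.1 h).1)]
      omega

end IsRootedOrder

theorem card_between_union {U W : Finset V} (h : Disjoint U W) (a b : V) :
    (between le (U ∪ W) a b).card = (between le U a b).card + (between le W a b).card := by
  rw [between, Finset.filter_union, Finset.card_union_of_disjoint]
  · rfl
  · exact Finset.disjoint_filter_filter h

namespace SepComputes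

/-- All pairs are compared and the smaller parity class is kept; the chain estimate holds for either
class. -/
theorem exists_halving (r : V) (W : Finset V) : ∃ f : SimpleGraph V → Finset V,
    SepComputes (fun G => G.IsTree) f (fun _ => W.card * W.card) ∧
      ∀ G : SimpleGraph V, G.IsTree → f G ⊆ W ∧ 2 * (f G).card ≤ W.card ∧
        ∀ a b, (between (Separates G r) W a b).card ≤
          2 * (between (Separates G r) (f G) a b).card + 1 := by
  -- The depth function is an argument so that `half` applies both to the recorded answers and to
  -- the true depths, which agree on `W`.
  let half : (V → ℕ) → Finset V := fun D =>
    if (W.filter fun x => Even (D x)).card ≤ (W.filter fun x => ¬ Even (D x)).card then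
      W.filter fun x => Even (D x) else W.filter fun x => ¬ Even (D x)
  have hq := ((filter_query (fun G : SimpleGraph V => G.IsTree) (W ×ˢ W) (fun _ => r)
      (fun e => e.1) (fun e => e.2)).map
      fun K => half fun x => (W.filter fun w => (w, x) ∈ K).card)
  have hdepth : ∀ G : SimpleGraph V,
      half (fun x => (W.filter fun w => (w, x) ∈
        (W ×ˢ W).filter fun e => Separates G r e.1 e.2).card) =
      half (depthIn (Separates G r) W) := by
    intro G
    have : ∀ x ∈ W, (W.filter fun w => (w, x) ∈
        (W ×ˢ W).filter fun e => Separates G r e.1 e.2).card = depthIn (Separates G r) W x := by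
      intro x hx
      rw [depthIn]
      congr 1
      refine Finset.filter_congr fun w hw => ?_
      simp [hw, hx]
    have h1 := Finset.filter_congr (s := W) (p := fun x => Even (W.filter fun w => (w, x) ∈
        (W ×ˢ W).filter fun e => Separates G r e.1 e.2).card)
        (q := fun x => Even (depthIn (Separates G r) W x)) fun x hx => by rw [this x hx]
    have h2 := Finset.filter_congr (s := W) (p := fun x => ¬ Even (W.filter fun w => (w, x) ∈
        (W ×ˢ W).filter fun e => Separates G r e.1 e.2).card)
        (q := fun x => ¬ Even (depthIn (Separates G r) W x)) fun x hx => by rw [this x hx]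
    simp only [half]
    rw [h1, h2]
  refine ⟨fun G => half (depthIn (Separates G r) W),
    hq.mono (fun _ h => h) (fun G _ => hdepth G) (fun _ _ => ?_), fun G hG => ?_⟩
  · rw [Finset.card_product]
  · have ho := isRootedOrder_separates hG.connected r
    have hsum := Finset.card_filter_add_card_filter_not (s := W)
      fun x => Even (depthIn (Separates G r) W x)
    simp only [half]
    split_ifs with h
    · exact ⟨Finset.filter_subset _ _, by omega, fun a b => by
        convert ho.card_between_le W a Even (fun n => Nat.even_add_one) _ b le_rfl⟩
    · exact ⟨Finset.filter_subset _ _, by omega, fun a b => by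
        convert ho.card_between_le W a (fun n => ¬ Even n)
          (fun n => not_congr Nat.even_add_one) _ b le_rfl⟩

/-- Halving blocks of size at most `s` separately costs only `s` queries per vertex. The price is an
error of 1 for each of at most |W|/s + 1 blocks; the inequality is multiplied by `s`. -/
theorem exists_chunked_halving (r : V) {s : ℕ} (hs : 0 < s) (m : ℕ) :
    ∀ W : Finset V, W.card ≤ m → ∃ f : SimpleGraph V → Finset V,
    SepComputes (fun G => G.IsTree) f (fun _ => s * W.card) ∧
      ∀ G : SimpleGraph V, G.IsTree → f G ⊆ W ∧ 2 * (f G).card ≤ W.card ∧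
        ∀ a b, s * (between (Separates G r) W a b).card ≤
          2 * (s * (between (Separates G r) (f G) a b).card) + W.card + s := by
  induction m using Nat.strong_induction_on with
  | _ m ih =>
    intro W hW
    rcases le_or_gt W.card s with hle | hlt
    · obtain ⟨f, hf, hf'⟩ := exists_halving r W
      refine ⟨f, hf.mono (fun _ h => h) (fun _ _ => rfl) (fun _ _ => Nat.mul_le_mul_right _ hle),
        fun G hG => ⟨(hf' G hG).1, (hf' G hG).2.1, fun a b => ?_⟩⟩
      have := Nat.mul_le_mul_left s ((hf' G hG).2.2 a b)
      linarith
    · obtain ⟨U, hU, hUs⟩ := Finset.exists_subset_card_eq hlt.le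
      have hcard := Finset.card_sdiff_add_card_eq_card hU
      obtain ⟨f, hf, hf'⟩ := exists_halving r U
      obtain ⟨g, hg, hg'⟩ := ih (W \ U).card (by omega) (W \ U) le_rfl
      refine ⟨fun G => f G ∪ g G, (hf.bind (g := fun A G => A ∪ g G)
        (p := fun _ _ => s * (W \ U).card) fun A => (hg.mono (fun _ h => h.1) (fun _ _ => rfl)
        (fun _ _ => le_rfl)).map fun B => A ∪ B).mono (fun _ h => h) (fun _ _ => rfl)
        (fun _ _ => ?_), fun G hG => ?_⟩
      · rw [hUs, ← mul_add]
        exact Nat.mul_le_mul_left s (by omega)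
      · obtain ⟨h1, h2, h3⟩ := hf' G hG
        obtain ⟨h4, h5, h6⟩ := hg' G hG
        have hdis : Disjoint U (W \ U) := Finset.disjoint_sdiff
        refine ⟨Finset.union_subset (h1.trans hU) (h4.trans Finset.sdiff_subset), ?_,
          fun a b => ?_⟩
        · have := Finset.card_union_le (f G) (g G)
          dsimp only
          omega
        · have hWU : between (Separates G r) W a b = between (Separates G r) (U ∪ W \ U) a b := by
            rw [Finset.union_sdiff_of_subset hU]
          rw [hWU, card_between_union hdis, card_between_union (hdis.mono h1 h4)]
          have h7 := Nat.mul_le_mul_left s (h3 a b)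
          have h8 := h6 a b
          rw [← hcard, hUs]
          linarith

/-- Sizes fall geometrically, so the costs sum to at most 2s|W|. The error of round j is doubled j
times while the set has been halved j times, so each round contributes at most |W|. The errors `s`
sum to (2^k - 1)s, hence the `+ s` on the left. -/
theorem exists_net (r : V) {s : ℕ} (hs : 0 < s) (k : ℕ) :
    ∀ W : Finset V, ∃ f : SimpleGraph V → Finset V,
    SepComputes (fun G => G.IsTree) f (fun _ => 2 * (s * W.card)) ∧
      ∀ G : SimpleGraph V, G.IsTree → 2 ^ k * (f G).card ≤ W.card ∧
        ∀ a b, s * (between (Separates G r) W a b).card + s ≤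
          2 ^ k * (s * (between (Separates G r) (f G) a b).card) + k * W.card + 2 ^ k * s := by
  induction k with
  | zero =>
    intro W
    refine ⟨fun _ => W, (const _ W).mono (fun _ h => h) (fun _ _ => rfl) (by simp), ?_⟩
    simp
  | succ k ih =>
    intro W
    obtain ⟨f, hf, hf'⟩ := exists_chunked_halving r hs W.card W le_rfl
    choose g hg hg' using ih
    refine ⟨fun G => g (f G) G, (hf.bind (p := fun A _ => 2 * (s * A.card)) fun A =>
      (hg A).mono (fun _ h => h.1) (fun _ _ => rfl) (fun _ _ => le_rfl)).mono
      (fun _ h => h) (fun _ _ => rfl) (fun G hG => ?_), fun G hG => ?_⟩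
    · have := Nat.mul_le_mul_left s (hf' G hG).2.1
      linarith
    · obtain ⟨-, h2, h3⟩ := hf' G hG
      obtain ⟨h4, h5⟩ := hg' (f G) G hG
      refine ⟨by rw [pow_succ]; linarith, fun a b => ?_⟩
      have h6 := h3 a b
      have h7 := h5 a b
      have h8 := Nat.mul_le_mul_left k h2
      rw [pow_succ]
      linarith

end SepComputes

/-- The vertices whose closest element of `F` strictly below is `p`. -/
noncomputable def hangingGroup [Fintype V] (le : V → V → Prop) (F : Finset V) (p : V) :
    Finset V :=
  Finset.univ.filter fun u => StrictRel le p u ∧ ∀ f ∈ F, StrictRel le p f → ¬ StrictRel le f u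

/-! ### Cutting the tree at a net and learning the pieces. -/

section Groups

variable [Fintype V] {F : Finset V} {p u : V}

theorem isHangingAt_hangingGroup (ho : IsRootedOrder le r) (F : Finset V) (p : V) :
    IsHangingAt le p (hangingGroup le F p) := by
  intro u hu
  simp only [hangingGroup, Finset.mem_filter, Finset.mem_univ, true_and] at hu ⊢
  exact ⟨hu.1, fun x hpx hxu => ⟨hpx, fun f hf hpf hfx =>
    hu.2 f hf hpf (ho.strict_of_strict_of_le hfx hxu)⟩⟩

theorem isHangingAt_univ_erase (ho : IsRootedOrder le r) :
    IsHangingAt le r (Finset.univ.erase r) := by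
  intro u hu
  simp only [Finset.mem_erase, Finset.mem_univ, and_true] at hu ⊢
  exact ⟨⟨ho.bot u, hu.symm⟩, fun x hx _ => hx.2.symm⟩

theorem exists_mem_hangingGroup (ho : IsRootedOrder le r) (hr : r ∈ F) (hu : StrictRel le r u) :
    ∃ p ∈ F, u ∈ hangingGroup le F p := by
  obtain ⟨p, hp, hmax⟩ := Finset.exists_max_image (F.filter fun f => StrictRel le f u)
    (depthIn le F) ⟨r, Finset.mem_filter.2 ⟨hr, hu⟩⟩
  rw [Finset.mem_filter] at hp
  refine ⟨p, hp.1, ?_⟩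
  simp only [hangingGroup, Finset.mem_filter, Finset.mem_univ, true_and]
  refine ⟨hp.2, fun f hf hpf hfu => ?_⟩
  have h1 := hmax f (Finset.mem_filter.2 ⟨hf, hfu⟩)
  have h2 := ho.depthIn_lt hf hpf
  omega

/-- Groups are disjoint: two net vertices below the same `u` are comparable, and the upper one
excludes `u` from the group of the lower. -/
theorem sum_card_hangingGroup_le (ho : IsRootedOrder le r) (F : Finset V) :
    ∑ p ∈ F, (hangingGroup le F p).card ≤ Fintype.card V := by
  rw [← Finset.card_biUnion]
  · exact Finset.card_le_univ _
  · intro p hp p' hp' hne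
    rw [Function.onFun, Finset.disjoint_left]
    intro u hu hu'
    simp only [hangingGroup, Finset.mem_filter, Finset.mem_univ, true_and] at hu hu'
    rcases ho.total_below hu.1.1 hu'.1.1 with h | h
    · exact hu.2 p' hp' ⟨h, hne⟩ hu'.1
    · exact hu'.2 p hp ⟨h, Ne.symm hne⟩ hu.1

theorem ncard_le_card_between (p u : V) :
    {z | le p z ∧ StrictRel le z u}.ncard ≤ (between le Finset.univ p u).card + 1 := by
  have hsub : {z | le p z ∧ StrictRel le z u} ⊆
      (insert p (between le Finset.univ p u) : Finset V) := by
    intro z hz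
    rw [Finset.mem_coe, Finset.mem_insert, between, Finset.mem_filter]
    by_cases h : z = p
    · exact Or.inl h
    · exact Or.inr ⟨Finset.mem_univ _, ⟨hz.1, Ne.symm h⟩, hz.2⟩
  have := Set.ncard_le_ncard hsub (Finset.finite_toSet _)
  rw [Set.ncard_coe_finset] at this
  exact this.trans (Finset.card_insert_le _ _)

theorem iUnion_parentPairs_hangingGroup (ho : IsRootedOrder le r) (hr : r ∈ F) :
    ⋃ p ∈ F, parentPairs le (hangingGroup le F p) = {e | ParentRel le e.1 e.2} := by
  ext ⟨x, y⟩
  simp only [Set.mem_iUnion, parentPairs, Set.mem_ofPred_eq]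
  constructor
  · rintro ⟨p, -, -, h⟩
    exact h
  · intro h
    obtain ⟨p, hp, hy⟩ := exists_mem_hangingGroup ho hr
      (ho.strict_of_le_of_strict (ho.bot x) h.1)
    exact ⟨p, hp, hy, h⟩

theorem SepComputes.graph_of_net (r : V) (F : Finset V) (d H : ℕ) :
    SepComputes (fun G => (G.IsTree ∧ HasDegreeAtMost G d) ∧ ∀ p ∈ insert r F,
        ∀ u ∈ hangingGroup (Separates G r) (insert r F) p,
          (between (Separates G r) Finset.univ p u).card + 1 ≤ H)
      (fun G => G)
      (fun _ => (F.card + 1) * Fintype.card V + 2 * (Fintype.card V * (H * d))) := by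
  set F' := insert r F with hF'
  -- The groups are read off the recorded answers alone, since only comparisons from net vertices
  -- matter.
  let grp : Finset (V × V) → V → Finset V := fun A p => hangingGroup (fun x y => (x, y) ∈ A) F' p
  have hgrp : ∀ G : SimpleGraph V, ∀ p ∈ F', grp ((F' ×ˢ Finset.univ).filter
      fun e => Separates G r e.1 e.2) p = hangingGroup (Separates G r) F' p := by
    intro G p hp
    refine Finset.filter_congr fun u _ => ?_
    have hs : ∀ f ∈ F', ∀ x, StrictRel (fun x y => (x, y) ∈ (F' ×ˢ Finset.univ).filter
        fun e => Separates G r e.1 e.2) f x ↔ StrictRel (Separates G r) f x := by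
      intro f hf x
      simp [StrictRel, hf]
    rw [hs p hp]
    refine and_congr_right fun _ => forall₂_congr fun f hf => ?_
    rw [hs p hp, hs f hf]
  refine ((filter_query _ (F' ×ˢ (Finset.univ : Finset V)) (fun _ => r)
    (fun e => e.1) (fun e => e.2)).bind
    (g := fun A G => graphOfPairs (⋃ p ∈ F', parentPairs (Separates G r) (grp A p)))
    (p := fun A G => ∑ p ∈ F', 2 * (chargedPairs (Separates G r) (grp A p)).card)
    fun A => (biUnion F' fun p hp =>
      (parentPairs_of_isHangingAt r _ p (grp A p) le_rfl).mono (fun G h => ⟨h.1.1.1, ?_⟩)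
      (fun _ _ => rfl) (fun _ _ => le_rfl)).map graphOfPairs).mono (fun _ h => h)
      (fun G hG => ?_) (fun G hG => ?_)
  · rw [← h.2, hgrp G p hp]
    exact isHangingAt_hangingGroup (isRootedOrder_separates h.1.1.1.connected r) _ _
  · rw [Set.iUnion₂_congr fun p hp => by rw [hgrp G p hp], iUnion_parentPairs_hangingGroup
      (isRootedOrder_separates hG.1.1.connected r) (Finset.mem_insert_self r F),
      graphOfPairs_eq hG.1.1]
  · have ho := isRootedOrder_separates hG.1.1.connected r
    refine Nat.add_le_add ?_ ?_
    · rw [Finset.card_product, Finset.card_univ]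
      exact Nat.mul_le_mul_right _ (Finset.card_insert_le _ _)
    · rw [← Finset.mul_sum]
      refine Nat.mul_le_mul_left 2 ?_
      refine le_trans (Finset.sum_le_sum fun p hp => ?_) ((Finset.sum_mul _ _ (H * d)).symm.le.trans
        (Nat.mul_le_mul_right _ (sum_card_hangingGroup_le ho F')))
      rw [hgrp G p hp]
      exact card_chargedPairs_le ho (isHangingAt_hangingGroup ho _ _)
        (ncard_parentRel_le hG.1.1 hG.1.2 r)
        fun u hu => (ncard_le_card_between p u).trans (hG.2 p hp u hu)

theorem between_eq_empty_of_mem_hangingGroup (hu : u ∈ hangingGroup le (insert r F) p) :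
    between le F p u = ∅ := by
  simp only [hangingGroup, Finset.mem_filter, Finset.mem_univ, true_and] at hu
  refine Finset.filter_eq_empty_iff.2 fun f hf h => ?_
  exact hu.2 f (Finset.mem_insert_of_mem hf) h.1 h.2

/-- In units of ns, the net costs 2, the grouping at most 5 and the groups, of depth at most 3s, at
most 6d. -/
theorem SepComputes.graph_of_degree_le (r : V) (d k : ℕ) {s : ℕ} (hs : 0 < s)
    (h₁ : Fintype.card V ≤ 2 * s ^ 2) (h₂ : k * Fintype.card V ≤ 2 * s ^ 2)
    (h₃ : 2 ^ k ≤ s) (h₄ : s < 2 ^ (k + 1)) :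
    SepComputes (fun G : SimpleGraph V => G.IsTree ∧ HasDegreeAtMost G d) (fun G => G)
      (fun _ => (7 + 6 * d) * (Fintype.card V * s)) := by
  obtain ⟨f, hf, hf'⟩ := exists_net r hs k (Finset.univ : Finset V)
  refine ((hf.mono (P' := fun G => G.IsTree ∧ HasDegreeAtMost G d) (fun _ h => h.1)
    (fun _ _ => rfl) (fun _ _ => le_rfl)).bind (g := fun _ G => G)
    (p := fun F _ => (F.card + 1) * Fintype.card V + 2 * (Fintype.card V * (3 * s * d)))
    fun F => (graph_of_net r F d (3 * s)).mono (fun G hG => ⟨hG.1, fun p hp u hu => ?_⟩)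
      (fun _ _ => rfl) (fun _ _ => le_rfl)).mono (fun _ h => h) (fun _ _ => rfl)
      (fun G hG => ?_)
  -- No net vertex lies strictly between `p` and `u`, so the net inequality leaves kn + 2^k s ≤ 3s²
  -- on the right.
  · have h := (hf' G hG.1.1).2 p u
    rw [hG.2, between_eq_empty_of_mem_hangingGroup hu, Finset.card_univ, Finset.card_empty] at h
    refine le_of_mul_le_mul_left (a := s) ?_ hs
    have := Nat.mul_le_mul_right s h₃
    nlinarith
  · have h := (hf' G hG.1).1
    rw [Finset.card_univ] at h ⊢
    -- s|F| ≤ 2 · 2^k |F| ≤ 2n ≤ 4s².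
    have hF : (f G).card ≤ 4 * s := by
      refine le_of_mul_le_mul_left (a := s) ?_ hs
      have := Nat.mul_le_mul_right (f G).card h₄.le
      rw [pow_succ] at this
      nlinarith
    have := Nat.mul_le_mul_right (Fintype.card V) (show (f G).card + 1 ≤ 5 * s by omega)
    nlinarith

theorem SepComputes.graph_of_root (r : V) :
    SepComputes (fun G => G.IsTree) (fun G => G)
      (fun G => 2 * (chargedPairs (Separates G r) (Finset.univ.erase r)).card) := by
  refine ((parentPairs_of_isHangingAt r _ r _ le_rfl).map graphOfPairs).mono
    (fun G hG => ⟨hG, isHangingAt_univ_erase (isRootedOrder_separates hG.connected r)⟩)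
    (fun G hG => ?_) (fun _ _ => le_rfl)
  have ho := isRootedOrder_separates hG.connected r
  rw [← graphOfPairs_eq hG r]
  congr 1
  ext ⟨x, y⟩
  simp only [parentPairs, Finset.mem_erase, Finset.mem_univ, and_true, Set.mem_ofPred_eq,
    graphOfPairs_eq hG r, and_iff_right_iff_imp]
  intro h
  exact (ho.strict_of_le_of_strict (ho.bot x) h.1).2.symm

/-- The algorithm may root anywhere: going through `r'`, every vertex is within 2h of `r`. -/
theorem card_chargedPairs_univ_erase_le {G : SimpleGraph V} (hG : G.IsTree) {d h : ℕ}
    (hd : HasDegreeAtMost G d) {r' : V} (hh : HasHeight G r' h) (r : V) :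
    (chargedPairs (Separates G r) (Finset.univ.erase r)).card ≤
      Fintype.card V * (2 * h * d) := by
  have ho := isRootedOrder_separates hG.connected r
  have hdist : ∀ u, G.dist r' u ≤ h := by
    intro u
    have h1 : G.edist r' u ≤ G.eccent r' := SimpleGraph.edist_le_eccent
    rw [hh, ← (hG.connected.preconnected r' u).coe_dist_eq_edist] at h1
    exact_mod_cast h1
  refine (card_chargedPairs_le ho (isHangingAt_univ_erase ho) (ncard_parentRel_le hG hd r)
    (H := 2 * h) fun u _ => ?_).trans (Nat.mul_le_mul_right _ (Finset.card_le_univ _))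
  have h1 : {z | Separates G r r z ∧ StrictRel (Separates G r) z u}.ncard ≤ G.dist r u :=
    (Set.ncard_le_ncard (fun z hz => hz.2) (Set.toFinite _)).trans
      (ncard_strictRel_le_dist hG.connected r u)
  have h2 := hG.connected.dist_triangle (u := r) (v := r') (w := u)
  rw [SimpleGraph.dist_comm (u := r) (v := r')] at h2
  have h3 := hdist r
  have h4 := hdist u
  omega

end Groups

end Net

/-! ### Choice of parameters and the theorem. -/

section Main

/-- The choice s = ⌈√(n log n)⌉ and k = ⌊log₂ s⌋ balances the error kn/s against s. The factors 2 in
the bounds by s² come from log 2 ≥ 1/2. -/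
theorem exists_net_parameters {n : ℕ} (hn : 2 ≤ n) : ∃ s k : ℕ, 0 < s ∧ n ≤ 2 * s ^ 2 ∧
    k * n ≤ 2 * s ^ 2 ∧ 2 ^ k ≤ s ∧ s < 2 ^ (k + 1) ∧
    (s : ℝ) ≤ 2 * √(n * Real.log n) := by
  have hn' : (2 : ℝ) ≤ n := by exact_mod_cast hn
  have hlog2 : (1 / 2 : ℝ) ≤ Real.log 2 := by linarith [Real.log_two_gt_d9]
  have hlog : Real.log 2 ≤ Real.log n := Real.log_le_log (by norm_num) hn'
  have hx : 1 ≤ (n : ℝ) * Real.log n := by nlinarith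
  have hsq : 1 ≤ √(n * Real.log n) := by rwa [Real.one_le_sqrt]
  set s := ⌈√(n * Real.log n)⌉₊ with hs
  have hs0 : 0 < s := Nat.ceil_pos.2 (by linarith)
  have hs1 : √(n * Real.log n) ≤ s := Nat.le_ceil _
  have hs2 : (n : ℝ) * Real.log n ≤ (s : ℝ) ^ 2 := (Real.sqrt_le_left (by positivity)).1 hs1
  have hsn : s ≤ n := by
    rw [hs, Nat.ceil_le, Real.sqrt_le_left (by positivity), sq]
    exact mul_le_mul_of_nonneg_left (Real.log_le_self (by positivity)) (by positivity)
  have hpow : 2 ^ Nat.log 2 s ≤ s := Nat.pow_log_le_self 2 hs0.ne'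
  refine ⟨s, Nat.log 2 s, hs0, ?_, ?_, hpow, Nat.lt_pow_succ_log_self (by norm_num) s, ?_⟩
  · have : (n : ℝ) ≤ 2 * (s : ℝ) ^ 2 := by nlinarith
    exact_mod_cast this
  · have h1 : (Nat.log 2 s : ℝ) * Real.log 2 ≤ Real.log n := by
      rw [← Real.log_pow]
      exact Real.log_le_log (by positivity) (by exact_mod_cast hpow.trans hsn)
    have h2 : (Nat.log 2 s : ℝ) ≤ 2 * Real.log n := by
      have : (0 : ℝ) ≤ Nat.log 2 s := Nat.cast_nonneg _
      nlinarith
    have : (Nat.log 2 s : ℝ) * n ≤ 2 * (s : ℝ) ^ 2 := by nlinarith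
    exact_mod_cast this
  · linarith [Nat.ceil_lt_add_one (Real.sqrt_nonneg ((n : ℝ) * Real.log n))]

theorem mainTheorem3 (d : ℕ) :
    (∃ C : ℝ, ∀ (V : Type u) [Fintype V], ∃ A : SepLearner V,
      ∀ T : SimpleGraph V, T.IsTree → HasDegreeAtMost T d →
        ∀ (r : V) (h : ℕ), HasHeight T r h →
          LearnsWithin A T (C * ((Fintype.card V : ℝ) * (h : ℝ)))) ∧
    (∃ C : ℝ, ∀ (V : Type u) [Fintype V], ∃ A : SepLearner V,
      ∀ T : SimpleGraph V, T.IsTree → HasDegreeAtMost T d →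
        LearnsWithin A T
          (C * ((Fintype.card V : ℝ) ^ (3 / 2 : ℝ) *
            Real.sqrt (Real.log (Fintype.card V : ℝ))))) := by
  constructor
  · refine ⟨4 * d, fun V _ => ?_⟩
    rcases isEmpty_or_nonempty V with hV | ⟨⟨r⟩⟩
    · exact ⟨.report ⊥, fun T _ _ r => isEmptyElim r⟩
    obtain ⟨A, hA⟩ := (SepComputes.graph_of_root r).exists_learner
    refine ⟨A, fun T hT hd r' h hh => ⟨(hA T hT).1, ?_⟩⟩
    have h1 := (hA T hT).2.trans
      (Nat.mul_le_mul_left 2 (card_chargedPairs_univ_erase_le hT hd hh r))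
    have h2 : (A.numQueries (sepQuery T) : ℝ) ≤ 2 * (Fintype.card V * (2 * h * d)) := by
      exact_mod_cast h1
    linarith
  · refine ⟨2 * (7 + 6 * d), fun V _ => ?_⟩
    rcases Nat.lt_or_ge (Fintype.card V) 2 with hn | hn
    -- For n ≤ 1 the bound is 0, so nothing may be asked.
    · have : Subsingleton V := Fintype.card_le_one_iff_subsingleton.1 (by omega)
      refine ⟨.report ⊥, fun T _ _ => ⟨Subsingleton.elim _ _, ?_⟩⟩
      simp only [SepLearner.numQueries, Nat.cast_zero]
      positivity
    obtain ⟨r⟩ : Nonempty V := Fintype.card_pos_iff.1 (by omega)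
    obtain ⟨s, k, hs, h1, h2, h3, h4, h5⟩ := exists_net_parameters hn
    obtain ⟨A, hA⟩ := (SepComputes.graph_of_degree_le r d k hs h1 h2 h3 h4).exists_learner
    refine ⟨A, fun T hT hd => ⟨(hA T ⟨hT, hd⟩).1, ?_⟩⟩
    have h6 : (A.numQueries (sepQuery T) : ℝ) ≤ (7 + 6 * d) * (Fintype.card V * s) := by
      exact_mod_cast (hA T ⟨hT, hd⟩).2
    have hpos : (0 : ℝ) < Fintype.card V := by exact_mod_cast (by omega : 0 < Fintype.card V)
    have h7 : (Fintype.card V : ℝ) ^ (3 / 2 : ℝ) = Fintype.card V * √(Fintype.card V) := by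
      rw [Real.sqrt_eq_rpow, ← Real.rpow_one_add' hpos.le (by norm_num)]
      norm_num
    rw [Real.sqrt_mul hpos.le] at h5
    rw [h7]
    have h8 := mul_le_mul_of_nonneg_left h5
      (show (0 : ℝ) ≤ (7 + 6 * d) * Fintype.card V by positivity)
    linarith

end Main
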